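/- Let $n \ge 0$ be an integer and let $\Omega \subset \mathbb{R}^{n+1} = \mathbb{R}^n \times \mathbb{R}$ be non-empty, open and bounded. Write points of $\mathbb{R}^{n+1}$ as $(x,t)$ with $x \in \mathbb{R}^n$, $t \in \mathbb{R}$, let $\Delta_x$ be the Laplacian in the variables $x$, and let $H = \Delta_x - \partial_t$ be the heat operator. Then there is a constant $c > 0$, depending only on $n$ and $\Omega$, such that for every smooth function $u : \Omega \to \mathbb{R}$ with $Hu \ge 1$ on $\Omega$ and every $1 \le p \le \infty$ with conjugate exponent $p'$ (that is, $1/p + 1/p' = 1$), $$\|u\|_{L^p(\Omega)} \cdot \bigl|\{(x,t) \in \Omega : |u(x,t)| \ge c\}\bigr|^{1/p'} \ge c,$$ where $|\cdot|$ of a set is Lebesgue measure, $\|u\|_{L^p(\Omega)}$ may be $+\infty$, and for $p = 1$ (where $1/p' = 0$) the second factor is $1$. In particular $c$ does not depend on $p$ or on $u$. -/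

import Mathlib

open MeasureTheory
open scoped ENNReal ContDiff

/-- The heat operator `H = Δ_x - ∂_t` on real functions of `(x, t) ∈ ℝⁿ × ℝ`, where `Δ_x` is the
Laplacian in the first `n` variables. -/
noncomputable def heatOperator {n : ℕ} (u : EuclideanSpace ℝ (Fin n) × ℝ → ℝ)
    (z : EuclideanSpace ℝ (Fin n) × ℝ) : ℝ :=
  Laplacian.laplacian (fun x => u (x, z.2)) z.1 - deriv (fun t => u (z.1, t)) z.2

/-!
The result follows by testing the differential inequality against a single bump function. Fix a
nonzero `φ ≥ 0` in `C_c^∞(Ω)`, and let `H* = Δ_x + ∂_t` be the formal adjoint of `H`. If `Hu ≥ 1` on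
`Ω`, then integration by parts (`integral_mul_heatOperator`) gives
`∫ φ ≤ ∫ φ · Hu = ∫ H*φ · u`. With `|H*φ| ≤ M`, splitting `Ω` according to whether `|u| ≥ c` yields
`∫ φ ≤ M (∫_{|u| ≥ c} |u| + c |Ω|)`, so for `c = ∫ φ / (M (1 + |Ω|))`, which depends on `Ω` only,
`∫_{|u| ≥ c} |u| ≥ c`. Hölder's inequality on `{|u| ≥ c}` then gives the estimate for every `p` at
once.
-/

section IntegrationByParts

variable {E : Type*} [NormedAddCommGroup E]

/-- A function which is only continuous on an open set becomes integrable after multiplication by a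
continuous function compactly supported in that set. -/
theorem integrable_mul_of_tsupport_subset [MeasurableSpace E] [BorelSpace E]
    {μ : Measure E} [IsFiniteMeasureOnCompacts μ] {Ω : Set E} (hΩ : IsOpen Ω) {φ f : E → ℝ}
    (hφ : Continuous φ) (hφc : HasCompactSupport φ) (hφΩ : tsupport φ ⊆ Ω) (hf : ContinuousOn f Ω) : Integrable (fun z => φ z * f z) μ := by
  refine Continuous.integrable_of_hasCompactSupport ?_ hφc.mul_right
  refine continuous_of_tsupport fun z hz => ?_
  have hzΩ : z ∈ Ω := hφΩ (tsupport_mul_subset_left hz)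
  exact hφ.continuousAt.mul (hf.continuousAt (hΩ.mem_nhds hzΩ))

variable [NormedSpace ℝ E]

theorem ContDiffOn.fderiv_apply_const {Ω : Set E} (hΩ : IsOpen Ω) {f : E → ℝ}
    (hf : ContDiffOn ℝ ∞ f Ω) (v : E) : ContDiffOn ℝ ∞ (fun z => fderiv ℝ f z v) Ω :=
  (hf.fderiv_of_isOpen hΩ (by simp)).clm_apply contDiffOn_const

theorem ContDiff.fderiv_apply_const {f : E → ℝ} (hf : ContDiff ℝ ∞ f) (v : E) :
    ContDiff ℝ ∞ (fun z => fderiv ℝ f z v) :=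
  (hf.fderiv_right (by simp)).clm_apply contDiff_const

variable [MeasurableSpace E] [BorelSpace E] [FiniteDimensional ℝ E] {μ : Measure E}
  [μ.IsAddHaarMeasure]

/-- Integration by parts against a test function supported in the open set `Ω`; the other factor
need only be smooth in `Ω`. -/
theorem integral_mul_fderiv_of_tsupport_subset {Ω : Set E} (hΩ : IsOpen Ω) {φ f : E → ℝ}
    (hφ : ContDiff ℝ ∞ φ) (hφc : HasCompactSupport φ) (hφΩ : tsupport φ ⊆ Ω)
    (hf : ContDiffOn ℝ ∞ f Ω) (v : E) :
    ∫ z, φ z * fderiv ℝ f z v ∂μ = -∫ z, fderiv ℝ φ z v * f z ∂μ := by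
  apply integral_mul_fderiv_eq_neg_fderiv_mul_of_integrable
  · exact integrable_mul_of_tsupport_subset hΩ (hφ.fderiv_apply_const v).continuous
      (hφc.fderiv_apply ℝ v) ((tsupport_fderiv_apply_subset ℝ v).trans hφΩ) hf.continuousOn
  · exact integrable_mul_of_tsupport_subset hΩ hφ.continuous hφc hφΩ
      (hf.fderiv_apply_const hΩ v).continuousOn
  · exact integrable_mul_of_tsupport_subset hΩ hφ.continuous hφc hφΩ hf.continuousOn
  · exact fun z _ => hφ.differentiable (by simp) z
  · exact fun z hz => (hf.contDiffAt (hΩ.mem_nhds (hφΩ hz))).differentiableAt (by simp)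

theorem integral_mul_fderiv_fderiv_of_tsupport_subset {Ω : Set E} (hΩ : IsOpen Ω) {φ f : E → ℝ}
    (hφ : ContDiff ℝ ∞ φ) (hφc : HasCompactSupport φ) (hφΩ : tsupport φ ⊆ Ω)
    (hf : ContDiffOn ℝ ∞ f Ω) (v : E) :
    ∫ z, φ z * fderiv ℝ (fun y => fderiv ℝ f y v) z v ∂μ =
      ∫ z, fderiv ℝ (fun y => fderiv ℝ φ y v) z v * f z ∂μ := by
  rw [integral_mul_fderiv_of_tsupport_subset hΩ hφ hφc hφΩ (hf.fderiv_apply_const hΩ v),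
    integral_mul_fderiv_of_tsupport_subset hΩ (hφ.fderiv_apply_const v) (hφc.fderiv_apply ℝ v)
      ((tsupport_fderiv_apply_subset ℝ v).trans hφΩ) hf, neg_neg]

end IntegrationByParts

/-- The formal adjoint `H* = Δ_x + ∂_t` of the heat operator, written in terms of iterated
directional derivatives on `ℝⁿ × ℝ`. -/
noncomputable def adjointHeatOperator {n : ℕ} (φ : EuclideanSpace ℝ (Fin n) × ℝ → ℝ)
    (z : EuclideanSpace ℝ (Fin n) × ℝ) : ℝ :=
  (∑ i, fderiv ℝ (fun y => fderiv ℝ φ y (EuclideanSpace.basisFun (Fin n) ℝ i, 0)) z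
    (EuclideanSpace.basisFun (Fin n) ℝ i, 0)) + fderiv ℝ φ z (0, 1)

variable {n : ℕ} {Ω : Set (EuclideanSpace ℝ (Fin n) × ℝ)}

/-- On `Ω`, where `u` is smooth, the partial derivatives in the definition of `heatOperator`, taken
along slices, are directional derivatives of `u` on the product space. -/
theorem heatOperator_eq_sum_fderiv (hΩ : IsOpen Ω) {u : EuclideanSpace ℝ (Fin n) × ℝ → ℝ}
    (hu : ContDiffOn ℝ ∞ u Ω) {z : EuclideanSpace ℝ (Fin n) × ℝ} (hz : z ∈ Ω) :
    heatOperator u z =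
      (∑ i, fderiv ℝ (fun y => fderiv ℝ u y (EuclideanSpace.basisFun (Fin n) ℝ i, 0)) z
        (EuclideanSpace.basisFun (Fin n) ℝ i, 0)) - fderiv ℝ u z (0, 1) := by
  have hd : ∀ y ∈ Ω, DifferentiableAt ℝ u y := fun y hy =>
    (hu.contDiffAt (hΩ.mem_nhds hy)).differentiableAt (by simp)
  have hslice : ∀ x : EuclideanSpace ℝ (Fin n),
      HasFDerivAt (fun x => (x, z.2)) (ContinuousLinearMap.inl ℝ _ ℝ) x := fun x =>
    hasFDerivAt_prodMk_left x z.2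
  have hcd : ContDiffAt ℝ ∞ (fun x => u (x, z.2)) z.1 :=
    (hu.contDiffAt (hΩ.mem_nhds hz)).comp z.1 (contDiff_prodMk_left z.2).contDiffAt
  unfold heatOperator
  congr 1
  · rw [InnerProductSpace.laplacian_eq_iteratedFDeriv_orthonormalBasis _
      (EuclideanSpace.basisFun (Fin n) ℝ)]
    refine Finset.sum_congr rfl fun i _ => ?_
    set e := EuclideanSpace.basisFun (Fin n) ℝ i
    have hdd : DifferentiableAt ℝ (fun y => fderiv ℝ u y (e, 0)) z :=
      ((hu.fderiv_apply_const hΩ _).contDiffAt (hΩ.mem_nhds hz)).differentiableAt (by simp)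
    have hev : (fun x => fderiv ℝ (fun x => u (x, z.2)) x e) =ᶠ[nhds z.1]
        fun x => fderiv ℝ u (x, z.2) (e, 0) := by
      have hmem : ∀ᶠ x in nhds z.1, (x, z.2) ∈ Ω :=
        (hslice z.1).continuousAt.eventually (hΩ.mem_nhds hz)
      filter_upwards [hmem] with x hx
      have h := (HasFDerivAt.comp x (f := fun x => (x, z.2)) (hd _ hx).hasFDerivAt
        (hslice x)).fderiv
      rw [Function.comp_def] at h
      rw [h]
      simp
    have hfd : DifferentiableAt ℝ (fderiv ℝ (fun x => u (x, z.2))) z.1 :=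
      (hcd.fderiv_right (m := ∞) (by simp)).differentiableAt (by simp)
    rw [iteratedFDeriv_two_apply]
    calc fderiv ℝ (fderiv ℝ (fun x => u (x, z.2))) z.1 e e
        = fderiv ℝ (fun x => fderiv ℝ (fun x => u (x, z.2)) x e) z.1 e := by
          rw [fderiv_clm_apply hfd (differentiableAt_const e)]
          simp
      _ = fderiv ℝ (fun x => fderiv ℝ u (x, z.2) (e, 0)) z.1 e := by rw [hev.fderiv_eq]
      _ = _ := by
          have h := (HasFDerivAt.comp z.1 (f := fun x => (x, z.2)) hdd.hasFDerivAt
            (hslice z.1)).fderiv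
          rw [Function.comp_def] at h
          rw [h]
          simp
  · have h := (hd z hz).hasFDerivAt.comp_hasDerivAt z.2
      (f := fun t => (z.1, t)) ((hasDerivAt_const z.2 z.1).prodMk (hasDerivAt_id z.2))
    exact h.deriv

theorem ContDiff.continuous_adjointHeatOperator {φ : EuclideanSpace ℝ (Fin n) × ℝ → ℝ}
    (hφ : ContDiff ℝ ∞ φ) : Continuous (adjointHeatOperator φ) :=
  (continuous_finsetSum _ fun _ _ =>
    ((hφ.fderiv_apply_const _).fderiv_apply_const _).continuous).add
    (hφ.fderiv_apply_const _).continuous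

theorem adjointHeatOperator_eq_zero {φ : EuclideanSpace ℝ (Fin n) × ℝ → ℝ}
    {z : EuclideanSpace ℝ (Fin n) × ℝ} (hz : z ∉ tsupport φ) : adjointHeatOperator φ z = 0 := by
  have h1 : ∀ v, z ∉ tsupport (fun y => fderiv ℝ φ y v) := fun v h =>
    hz (tsupport_fderiv_apply_subset ℝ v h)
  have h2 : ∀ v, z ∉ tsupport (fun y => fderiv ℝ (fun y => fderiv ℝ φ y v) y v) := fun v h =>
    h1 v (tsupport_fderiv_apply_subset ℝ v h)
  simp only [adjointHeatOperator]
  rw [image_eq_zero_of_notMem_tsupport (h1 _), add_zero]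
  refine Finset.sum_eq_zero fun i _ => ?_
  have h := image_eq_zero_of_notMem_tsupport (h2 (EuclideanSpace.basisFun (Fin n) ℝ i, 0))
  exact h

theorem integrable_mul_heatOperator (hΩ : IsOpen Ω) {φ u : EuclideanSpace ℝ (Fin n) × ℝ → ℝ}
    (hφ : ContDiff ℝ ∞ φ) (hφc : HasCompactSupport φ) (hφΩ : tsupport φ ⊆ Ω)
    (hu : ContDiffOn ℝ ∞ u Ω) : Integrable fun z => φ z * heatOperator u z := by
  refine integrable_mul_of_tsupport_subset hΩ hφ.continuous hφc hφΩ ?_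
  refine ContinuousOn.congr ?_ fun z hz => heatOperator_eq_sum_fderiv hΩ hu hz
  exact (continuousOn_finsetSum _ fun _ _ =>
    ((hu.fderiv_apply_const hΩ _).fderiv_apply_const hΩ _).continuousOn).sub
    (hu.fderiv_apply_const hΩ _).continuousOn

/-- Integration by parts moves the heat operator onto the test function as its formal adjoint. -/
theorem integral_mul_heatOperator (hΩ : IsOpen Ω) {φ u : EuclideanSpace ℝ (Fin n) × ℝ → ℝ}
    (hφ : ContDiff ℝ ∞ φ) (hφc : HasCompactSupport φ) (hφΩ : tsupport φ ⊆ Ω)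
    (hu : ContDiffOn ℝ ∞ u Ω) :
    ∫ z, φ z * heatOperator u z = ∫ z, adjointHeatOperator φ z * u z := by
  have : (volume : Measure (EuclideanSpace ℝ (Fin n) × ℝ)).IsAddHaarMeasure :=
    Measure.prod.instIsAddHaarMeasure _ _
  have hpt : ∀ z, φ z * heatOperator u z =
      (∑ i, φ z * fderiv ℝ (fun y => fderiv ℝ u y (EuclideanSpace.basisFun (Fin n) ℝ i, 0)) z
        (EuclideanSpace.basisFun (Fin n) ℝ i, 0)) - φ z * fderiv ℝ u z (0, 1) := by
    intro z
    by_cases hz : z ∈ Ω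
    · rw [heatOperator_eq_sum_fderiv hΩ hu hz, mul_sub, Finset.mul_sum]
    · simp [image_eq_zero_of_notMem_tsupport fun h => hz (hφΩ h)]
  have hI : ∀ {ψ f : EuclideanSpace ℝ (Fin n) × ℝ → ℝ}, ContDiff ℝ ∞ ψ → HasCompactSupport ψ →
      tsupport ψ ⊆ Ω → ContDiffOn ℝ ∞ f Ω → Integrable fun z => ψ z * f z := fun h1 h2 h3 h4 =>
    integrable_mul_of_tsupport_subset hΩ h1.continuous h2 h3 h4.continuousOn
  have hD : ∀ v, Integrable fun z => fderiv ℝ φ z v * u z := fun v =>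
    hI (hφ.fderiv_apply_const v) (hφc.fderiv_apply ℝ v)
      ((tsupport_fderiv_apply_subset ℝ v).trans hφΩ) hu
  have hDD : ∀ v, Integrable fun z => fderiv ℝ (fun y => fderiv ℝ φ y v) z v * u z := fun v =>
    hI ((hφ.fderiv_apply_const v).fderiv_apply_const v) ((hφc.fderiv_apply ℝ v).fderiv_apply ℝ v)
      ((tsupport_fderiv_apply_subset ℝ v).trans
        ((tsupport_fderiv_apply_subset ℝ v).trans hφΩ)) hu
  simp only [hpt, adjointHeatOperator, add_mul, Finset.sum_mul]
  rw [integral_sub (integrable_finsetSum _ fun i _ => hI hφ hφc hφΩ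
      ((hu.fderiv_apply_const hΩ _).fderiv_apply_const hΩ _))
      (hI hφ hφc hφΩ (hu.fderiv_apply_const hΩ _)),
    integral_add (integrable_finsetSum _ fun i _ => hDD _) (hD _),
    integral_finsetSum _ fun i _ => hDD _,
    integral_finsetSum _ fun i _ => hI hφ hφc hφΩ
      ((hu.fderiv_apply_const hΩ _).fderiv_apply_const hΩ _),
    integral_mul_fderiv_of_tsupport_subset hΩ hφ hφc hφΩ hu, sub_neg_eq_add]
  congr 1
  exact Finset.sum_congr rfl fun i _ =>
    integral_mul_fderiv_fderiv_of_tsupport_subset hΩ hφ hφc hφΩ hu _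

/-- The case `p = 1`, with the norm taken over the superlevel set only; this is stronger than the
`L¹(Ω)` bound and implies the estimate for all other `p` by Hölder's inequality. -/
theorem exists_ofReal_le_lintegral_superlevel (hΩ : IsOpen Ω) (hΩb : Bornology.IsBounded Ω)
    (hΩn : Ω.Nonempty) :
    ∃ c : ℝ, 0 < c ∧ ∀ u : EuclideanSpace ℝ (Fin n) × ℝ → ℝ, ContDiffOn ℝ ∞ u Ω →
      (∀ z ∈ Ω, 1 ≤ heatOperator u z) →
        ENNReal.ofReal c ≤ ∫⁻ z in {z ∈ Ω | c ≤ |u z|}, ‖u z‖ₑ := by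
  obtain ⟨z₀, hz₀⟩ := hΩn
  obtain ⟨φ, hφΩ, hφc, hφ, hφr, hφ1⟩ :=
    exists_contDiff_tsupport_subset (n := ⊤) (hΩ.mem_nhds hz₀)
  have hφ0 : ∀ z, 0 ≤ φ z := fun z => (hφr ⟨z, rfl⟩).1
  have hA : 0 < ∫ z, φ z := hφ.continuous.integral_pos_of_hasCompactSupport_nonneg_nonzero hφc hφ0
    (x := z₀) (by simp [hφ1])
  obtain ⟨M, hM⟩ : ∃ M : ℝ, ∀ z, ‖adjointHeatOperator φ z‖ ≤ M :=
    hφ.continuous_adjointHeatOperator.bounded_above_of_compact_support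
      (HasCompactSupport.intro hφc fun z hz => adjointHeatOperator_eq_zero hz)
  -- Enlarging the bound makes it positive, as is needed to divide by it.
  obtain ⟨M, hM0, hM⟩ : ∃ M : ℝ, 0 < M ∧ ∀ z, ‖adjointHeatOperator φ z‖ ≤ M :=
    ⟨max M 1, by positivity, fun z => (hM z).trans (le_max_left _ _)⟩
  have hV : volume Ω ≠ ⊤ := hΩb.measure_lt_top.ne
  set V : ℝ := (volume Ω).toReal with hVdef
  have hV0 : 0 ≤ V := ENNReal.toReal_nonneg
  set c : ℝ := (∫ z, φ z) / (M * (1 + V)) with hc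
  have hc0 : 0 < c := by positivity
  have hcA : ∫ z, φ z = M * (c + c * V) := by
    rw [hc]
    field_simp
  refine ⟨c, hc0, fun u hu hHu => ?_⟩
  set S := {z ∈ Ω | c ≤ |u z|}
  have h1 : ∫ z, φ z ≤ ∫ z, adjointHeatOperator φ z * u z := by
    rw [← integral_mul_heatOperator hΩ hφ hφc hφΩ hu]
    refine integral_mono (hφ.continuous.integrable_of_hasCompactSupport hφc)
      (integrable_mul_heatOperator hΩ hφ hφc hφΩ hu) fun z => ?_
    by_cases hz : z ∈ Ω
    · exact le_mul_of_one_le_right (hφ0 z) (hHu z hz)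
    · simp [image_eq_zero_of_notMem_tsupport fun h => hz (hφΩ h)]
  have h2 : ENNReal.ofReal (∫ z, φ z) ≤ ∫⁻ z in Ω, ‖adjointHeatOperator φ z‖ₑ * ‖u z‖ₑ := by
    have h0 : ∫ z, adjointHeatOperator φ z * u z = ∫ z in Ω, adjointHeatOperator φ z * u z :=
      (setIntegral_eq_integral_of_forall_compl_eq_zero fun z hz => by
        rw [adjointHeatOperator_eq_zero fun h => hz (hφΩ h), zero_mul]).symm
    calc ENNReal.ofReal (∫ z, φ z)
        ≤ ENNReal.ofReal ‖∫ z in Ω, adjointHeatOperator φ z * u z‖ :=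
          ENNReal.ofReal_le_ofReal ((h1.trans_eq h0).trans (le_abs_self _))
      _ = ‖∫ z in Ω, adjointHeatOperator φ z * u z‖ₑ := ofReal_norm _
      _ ≤ ∫⁻ z in Ω, ‖adjointHeatOperator φ z * u z‖ₑ := enorm_integral_le_lintegral_enorm _
      _ = _ := by simp only [enorm_mul]
  have hMe : ∀ z, ‖adjointHeatOperator φ z‖ₑ ≤ ENNReal.ofReal M := fun z => by
    rw [← ofReal_norm]
    exact ENNReal.ofReal_le_ofReal (hM z)
  have h3 : ∫⁻ z in S, ‖adjointHeatOperator φ z‖ₑ * ‖u z‖ₑ ≤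
      ENNReal.ofReal M * ∫⁻ z in S, ‖u z‖ₑ := by
    rw [← lintegral_const_mul' _ _ ENNReal.ofReal_ne_top]
    gcongr with z
    exact hMe z
  have h4 : ∫⁻ z in Ω \ S, ‖adjointHeatOperator φ z‖ₑ * ‖u z‖ₑ ≤
      ENNReal.ofReal M * (ENNReal.ofReal c * volume Ω) := by
    calc ∫⁻ z in Ω \ S, ‖adjointHeatOperator φ z‖ₑ * ‖u z‖ₑ
        ≤ ∫⁻ _ in Ω \ S, ENNReal.ofReal M * ENNReal.ofReal c := by
          refine setLIntegral_mono measurable_const fun z hz => mul_le_mul' (hMe z) ?_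
          rw [← ofReal_norm]
          refine ENNReal.ofReal_le_ofReal (le_of_not_ge fun h => hz.2 ⟨hz.1, h⟩)
      _ = ENNReal.ofReal M * ENNReal.ofReal c * volume (Ω \ S) := setLIntegral_const _ _
      _ ≤ _ := by
          rw [← mul_assoc]
          gcongr
          exact Set.sdiff_subset
  have h5 : ENNReal.ofReal (∫ z, φ z) ≤
      ENNReal.ofReal M * ((∫⁻ z in S, ‖u z‖ₑ) + ENNReal.ofReal c * volume Ω) := by
    rw [mul_add]
    refine (h2.trans ?_).trans (add_le_add h3 h4)
    have hΩS : S ∪ (Ω \ S) = Ω := Set.union_sdiff_cancel fun z hz => hz.1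
    simpa only [hΩS] using lintegral_union_le (μ := volume)
      (fun z => ‖adjointHeatOperator φ z‖ₑ * ‖u z‖ₑ) S (Ω \ S)
  rw [hcA, ENNReal.ofReal_mul hM0.le, ENNReal.ofReal_add hc0.le (by positivity),
    ENNReal.ofReal_mul hc0.le, hVdef, ENNReal.ofReal_toReal hV,
    ENNReal.mul_le_mul_iff_right (by simpa using hM0) ENNReal.ofReal_ne_top] at h5
  exact (ENNReal.add_le_add_iff_right (ENNReal.mul_ne_top ENNReal.ofReal_ne_top hV)).1 h5

theorem theorem2 (n : ℕ) (Ω : Set (EuclideanSpace ℝ (Fin n) × ℝ)) (hΩ_open : IsOpen Ω)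
    (hΩ_bdd : Bornology.IsBounded Ω) (hΩ_ne : Ω.Nonempty) :
    ∃ c : ℝ, 0 < c ∧
      ∀ u : EuclideanSpace ℝ (Fin n) × ℝ → ℝ, ContDiffOn ℝ ∞ u Ω →
        (∀ z ∈ Ω, 1 ≤ heatOperator u z) →
        ∀ p p' : ℝ≥0∞, 1 ≤ p → ENNReal.HolderConjugate p p' →
          ENNReal.ofReal c ≤
            eLpNorm u p (volume.restrict Ω) *
              volume {z ∈ Ω | c ≤ |u z|} ^ (1 / p').toReal := by
  obtain ⟨c, hc0, hc⟩ := exists_ofReal_le_lintegral_superlevel hΩ_open hΩ_bdd hΩ_ne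
  refine ⟨c, hc0, fun u hu hHu p p' hp hpp' => (hc u hu hHu).trans ?_⟩
  have hsub : volume.restrict {z ∈ Ω | c ≤ |u z|} ≤ volume.restrict Ω :=
    Measure.restrict_mono_set _ fun z hz => hz.1
  have hmeas : AEStronglyMeasurable u (volume.restrict {z ∈ Ω | c ≤ |u z|}) :=
    (hu.continuousOn.aestronglyMeasurable hΩ_open.measurableSet).mono_measure hsub
  have hexp : 1 / (1 : ℝ≥0∞).toReal - 1 / p.toReal = (1 / p').toReal := by
    have h : p⁻¹ + p'⁻¹ = 1 := by simpa using hpp'.inv_add_inv_eq_inv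
    have hp' : p'⁻¹ = 1 - p⁻¹ := by
      rw [← h, ENNReal.add_sub_cancel_left (by simp; positivity)]
    rw [one_div p', hp', ENNReal.toReal_sub_of_le (by simpa using hp) ENNReal.one_ne_top]
    simp
  rw [← eLpNorm_one_eq_lintegral_enorm, ← hexp]
  refine (eLpNorm_le_eLpNorm_mul_rpow_measure_univ hp hmeas).trans ?_
  rw [Measure.restrict_apply_univ]
  gcongr
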